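/- Let $\mathrm{Prob}_2(\mathbb R)$ be the set of probability measures on $\mathbb R$ that are absolutely continuous with respect to Lebesgue measure and have finite second moment, and let $W_2$ be the Wasserstein distance, $W_2^2(\mu,\nu)=\inf_{\gamma}\int |x-y|^2\,d\gamma(x,y)$, the infimum being over all couplings $\gamma$ of $\mu$ and $\nu$. A geodesic is a curve $\mu:[0,1]\to\mathrm{Prob}_2(\mathbb R)$ with $W_2(\mu(s),\mu(t))=|s-t|\,W_2(\mu(0),\mu(1))$ for all $s,t\in[0,1]$. Let $\nu_i=\mathcal N(m_i,\sigma_i^2)$, $i=1,\dots,n$, with $m_i\in\mathbb R$ and $\sigma_i>0$, be univariate Gaussian distributions that are not all equal. Let $t\in[0,1]\mapsto\mu(t)$ be a first principal geodesic component of $\nu_1,\dots,\nu_n$, that is, a geodesic that attains $$\inf_{t\mapsto\mu(t)\ \text{geodesic in } \mathrm{Prob}_2(\mathbb R)}\ \sum_{i=1}^n\ \inf_{t\in[0,1]} W_2^2(\mu(t),\nu_i).$$ Then $\mu(t)$ is a (non-degenerate) Gaussian distribution for every $t\in[0,1]$. -/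

import Mathlib

open MeasureTheory ProbabilityTheory
open scoped ENNReal NNReal

namespace GeodesicPCA

/-- The absolutely continuous probability measures on the real line with finite second moment. -/
def Prob₂ : Set (Measure ℝ) :=
  {μ | IsProbabilityMeasure μ ∧ μ ≪ volume ∧ MemLp (fun x : ℝ ↦ x) 2 μ}

/-- The couplings (transport plans) between two measures on the real line. -/
def couplings (μ ν : Measure ℝ) : Set (Measure (ℝ × ℝ)) :=
  {γ | γ.fst = μ ∧ γ.snd = ν}

/-- The Wasserstein distance of order two: the square root of the optimal total transport cost
for the squared Euclidean distance. -/
noncomputable def W₂ (μ ν : Measure ℝ) : ℝ≥0∞ :=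
  (⨅ γ ∈ couplings μ ν, ∫⁻ p, edist p.1 p.2 ^ 2 ∂γ) ^ (1 / 2 : ℝ)

/-- `μ : [0, 1] → Prob₂` is a (minimizing, constant speed) geodesic for the metric `W₂`. -/
def IsGeodesic (μ : unitInterval → Measure ℝ) : Prop :=
  (∀ t, μ t ∈ Prob₂) ∧
    ∀ s t : unitInterval, W₂ (μ s) (μ t) = ENNReal.ofReal |(s : ℝ) - t| * W₂ (μ 0) (μ 1)

/-- The sum of the squared residuals of the projections of `ν 1, …, ν n` on the curve `μ`. -/
noncomputable def cost {n : ℕ} (ν : Fin n → Measure ℝ) (μ : unitInterval → Measure ℝ) : ℝ≥0∞ :=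
  ∑ i, ⨅ t, W₂ (μ t) (ν i) ^ 2

/-- `μ` is a first principal geodesic component of `ν 1, …, ν n`: among all the geodesics of
`Prob₂` it minimizes the sum of squared residuals. -/
def IsFirstComponent {n : ℕ} (ν : Fin n → Measure ℝ) (μ : unitInterval → Measure ℝ) : Prop :=
  IsGeodesic μ ∧ ∀ η : unitInterval → Measure ℝ, IsGeodesic η → cost ν μ ≤ cost ν η

end GeodesicPCA

/-! On the line the optimal coupling is comonotone (`W₂_map_map`), so sending a measure to its
monotone rearrangement from γ = N(0,1) embeds `Prob₂` isometrically in L²(γ). Geodesics become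
segments, and Gaussians become affine functions of positive slope. Orthogonal projection onto the
affine functions fixes the data and sends the segment of `μ` to a segment of positive slopes
(`integral_mul_pos`), that is, to a competing Gaussian geodesic. By Pythagoras, minimality forces
the nearest point to each datum to be affine already. If two of these points have distinct
parameters, the whole segment is affine. Otherwise the curve does no better than a single Gaussian,
and a segment from it to a datum different from it costs strictly less
(`exists_isGeodesic_cost_lt`). -/

namespace GeodesicPCA

/-! ### Optimality of the comonotone coupling -/

section Comonotone

variable {Ω : Type*} [MeasurableSpace Ω]

/-- Both sides are the area of the square `[a, b)²`. With min and max, each point imposes just two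
thresholds, in increasing order. -/
lemma ofReal_sub_sq_eq_lintegral (a b : ℝ) :
    ENNReal.ofReal (b - a) ^ 2 =
      ∫⁻ p : ℝ × ℝ, {q : ℝ × ℝ | a ≤ min q.1 q.2 ∧ max q.1 q.2 < b}.indicator 1 p := by
  have h : {q : ℝ × ℝ | a ≤ min q.1 q.2 ∧ max q.1 q.2 < b} = Set.Ico a b ×ˢ Set.Ico a b := by
    ext q
    simp only [Set.mem_ofPred_eq, le_min_iff, max_lt_iff, Set.mem_prod, Set.mem_Ico]
    tauto
  rw [h, lintegral_indicator_one (measurableSet_Ico.prod measurableSet_Ico), Measure.volume_eq_prod,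
    Measure.prod_prod, Real.volume_Ico, sq]

lemma lintegral_ofReal_sub_sq (P : Measure Ω) [SFinite P] {X Y : Ω → ℝ} (hX : Measurable X)
    (hY : Measurable Y) :
    ∫⁻ ω, ENNReal.ofReal (Y ω - X ω) ^ 2 ∂P =
      ∫⁻ p : ℝ × ℝ, P {ω | X ω ≤ min p.1 p.2 ∧ max p.1 p.2 < Y ω} := by
  simp_rw [ofReal_sub_sq_eq_lintegral]
  have hS : MeasurableSet
      {q : Ω × (ℝ × ℝ) | X q.1 ≤ min q.2.1 q.2.2 ∧ max q.2.1 q.2.2 < Y q.1} :=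
    MeasurableSet.inter (s₁ := {q : Ω × (ℝ × ℝ) | X q.1 ≤ min q.2.1 q.2.2})
      (s₂ := {q : Ω × (ℝ × ℝ) | max q.2.1 q.2.2 < Y q.1})
      (measurableSet_le (by fun_prop) (by fun_prop)) (measurableSet_lt (by fun_prop) (by fun_prop))
  rw [lintegral_lintegral_swap]
  · refine lintegral_congr fun p ↦ ?_
    have hp : MeasurableSet {ω | X ω ≤ min p.1 p.2 ∧ max p.1 p.2 < Y ω} :=
      MeasurableSet.inter (s₁ := {ω | X ω ≤ min p.1 p.2}) (s₂ := {ω | max p.1 p.2 < Y ω})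
        (measurableSet_le hX measurable_const) (measurableSet_lt measurable_const hY)
    rw [← lintegral_indicator_one hp]
    rfl
  · exact (measurable_one.indicator hS).aemeasurable

/-- Among all pairs of random variables with given laws, the positive part of the difference has
the smallest second moment for a comonotone pair. -/
lemma lintegral_ofReal_sub_sq_le_of_monotone (ρ : Measure ℝ) [IsProbabilityMeasure ρ] {T S : ℝ → ℝ}
    (hT : Monotone T) (hS : Monotone S) (P : Measure Ω) [IsProbabilityMeasure P] {X Y : Ω → ℝ}
    (hX : Measurable X) (hY : Measurable Y) (hXT : P.map X = ρ.map T) (hYS : P.map Y = ρ.map S) :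
    ∫⁻ z, ENNReal.ofReal (S z - T z) ^ 2 ∂ρ ≤ ∫⁻ ω, ENNReal.ofReal (Y ω - X ω) ^ 2 ∂P := by
  rw [lintegral_ofReal_sub_sq ρ hT.measurable hS.measurable, lintegral_ofReal_sub_sq P hX hY]
  refine lintegral_mono fun p ↦ ?_
  set s := min p.1 p.2
  set t := max p.1 p.2
  have hT' : MeasurableSet {z | T z ≤ s} := measurableSet_le hT.measurable measurable_const
  have hS' : MeasurableSet {z | S z ≤ t} := measurableSet_le hS.measurable measurable_const
  have hX' : P {ω | X ω ≤ s} = ρ {z | T z ≤ s} := by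
    have h : P.map X (Set.Iic s) = ρ.map T (Set.Iic s) := by rw [hXT]
    rwa [Measure.map_apply hX measurableSet_Iic,
      Measure.map_apply hT.measurable measurableSet_Iic] at h
  have hY' : P {ω | Y ω ≤ t} = ρ {z | S z ≤ t} := by
    have h : P.map Y (Set.Iic t) = ρ.map S (Set.Iic t) := by rw [hYS]
    rwa [Measure.map_apply hY measurableSet_Iic,
      Measure.map_apply hS.measurable measurableSet_Iic] at h
  have e1 : {z | T z ≤ s ∧ t < S z} = {z | T z ≤ s} \ {z | S z ≤ t} := by
    ext z; simp
  have e2 : {ω | X ω ≤ s ∧ t < Y ω} = {ω | X ω ≤ s} \ {ω | Y ω ≤ t} := by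
    ext z; simp
  have lT : IsLowerSet {z | T z ≤ s} := fun a b hab (ha : T a ≤ s) ↦ (hT hab).trans ha
  have lS : IsLowerSet {z | S z ≤ t} := fun a b hab (ha : S a ≤ t) ↦ (hS hab).trans ha
  -- The measure of a difference is at least the difference of the measures, which depends on the
  -- marginals only. Lower sets of the line are nested, so the comonotone pair attains this bound or
  -- gives 0.
  rw [e1, e2]
  rcases lT.total lS with h | h
  · simp [Set.sdiff_eq_empty.2 h]
  · rw [measure_sdiff h hS'.nullMeasurableSet (measure_ne_top _ _), ← hX', ← hY']
    exact le_measure_sdiff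

lemma edist_sq_eq_add (x y : ℝ) :
    edist x y ^ 2 = ENNReal.ofReal (y - x) ^ 2 + ENNReal.ofReal (x - y) ^ 2 := by
  rw [edist_dist, Real.dist_eq]
  rcases le_total x y with h | h
  · rw [ENNReal.ofReal_of_nonpos (sub_nonpos.2 h), abs_sub_comm, abs_of_nonneg (sub_nonneg.2 h)]
    simp
  · rw [ENNReal.ofReal_of_nonpos (sub_nonpos.2 h), abs_of_nonneg (sub_nonneg.2 h)]
    simp

lemma lintegral_edist_sq_le_of_monotone (ρ : Measure ℝ) [IsProbabilityMeasure ρ] {T S : ℝ → ℝ}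
    (hT : Monotone T) (hS : Monotone S) (P : Measure Ω) [IsProbabilityMeasure P] {X Y : Ω → ℝ}
    (hX : Measurable X) (hY : Measurable Y) (hXT : P.map X = ρ.map T) (hYS : P.map Y = ρ.map S) :
    ∫⁻ z, edist (T z) (S z) ^ 2 ∂ρ ≤ ∫⁻ ω, edist (X ω) (Y ω) ^ 2 ∂P := by
  have := hT.measurable
  have := hS.measurable
  simp_rw [edist_sq_eq_add]
  rw [lintegral_add_left (by fun_prop), lintegral_add_left (by fun_prop)]
  exact add_le_add (lintegral_ofReal_sub_sq_le_of_monotone ρ hT hS P hX hY hXT hYS)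
    (lintegral_ofReal_sub_sq_le_of_monotone ρ hS hT P hY hX hYS hXT)

/-- The Wasserstein distance between two measures is attained by a comonotone coupling. -/
lemma W₂_map_map (ρ : Measure ℝ) [IsProbabilityMeasure ρ] {T S : ℝ → ℝ} (hT : Monotone T)
    (hS : Monotone S) : W₂ (ρ.map T) (ρ.map S) = eLpNorm (T - S) 2 ρ := by
  have mT := hT.measurable
  have mS := hS.measurable
  have key : ⨅ γ ∈ couplings (ρ.map T) (ρ.map S), ∫⁻ p, edist p.1 p.2 ^ 2 ∂γ =
      ∫⁻ z, edist (T z) (S z) ^ 2 ∂ρ := by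
    apply le_antisymm
    · refine (iInf₂_le (ρ.map fun z ↦ (T z, S z))
        ⟨Measure.fst_map_prodMk mS, Measure.snd_map_prodMk mT⟩).trans_eq ?_
      rw [lintegral_map (by fun_prop) (by fun_prop)]
    · refine le_iInf₂ fun γ hγ ↦ ?_
      have : IsProbabilityMeasure (ρ.map T) := Measure.isProbabilityMeasure_map mT.aemeasurable
      have : IsProbabilityMeasure γ :=
        ⟨by rw [← Measure.fst_univ, hγ.1]; exact measure_univ⟩
      exact lintegral_edist_sq_le_of_monotone ρ hT hS γ measurable_fst measurable_snd hγ.1 hγ.2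
  rw [W₂, key, eLpNorm_eq_lintegral_rpow_enorm_toReal (by simp) (by simp)]
  simp [edist_eq_enorm_sub]

end Comonotone

/-! ### Quantile maps -/

section Rearrangement

lemma strictMono_cdf (ρ : Measure ℝ) [IsProbabilityMeasure ρ] [ρ.IsOpenPosMeasure] :
    StrictMono (cdf ρ) := by
  intro x y hxy
  rw [cdf_eq_real, cdf_eq_real, ← sub_pos, ← measureReal_sdiff (Set.Iic_subset_Iic.2 hxy.le)
    measurableSet_Iic]
  refine ENNReal.toReal_pos (fun h ↦ ?_) (measure_ne_top _ _)
  exact isOpen_Ioo.measure_ne_zero ρ (Set.nonempty_Ioo.2 hxy)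
    (measure_mono_null (fun z (hz : z ∈ Set.Ioo x y) ↦
      show z ∈ Set.Iic y \ Set.Iic x from ⟨hz.2.le, not_le.2 hz.1⟩) h)

lemma continuous_cdf (ρ : Measure ℝ) [IsProbabilityMeasure ρ] [NullSingletonClass ρ] :
    Continuous (cdf ρ) := by
  refine continuous_iff_continuousAt.2 fun x ↦ ?_
  rw [(monotone_cdf ρ).continuousAt_iff_leftLim_eq_rightLim, (cdf ρ).rightLim_eq]
  refine le_antisymm ((monotone_cdf ρ).leftLim_le le_rfl) ?_
  have h : (cdf ρ).measure {x} = 0 := by rw [measure_cdf]; exact measure_singleton x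
  rw [StieltjesFunction.measure_singleton, ENNReal.ofReal_eq_zero] at h
  linarith

/-- Every probability measure on the line is the image under a monotone map of any given atomless
probability measure of full support. -/
lemma exists_monotone_map_eq (ρ μ : Measure ℝ) [IsProbabilityMeasure ρ] [ρ.IsOpenPosMeasure]
    [NullSingletonClass ρ] [IsProbabilityMeasure μ] : ∃ T : ℝ → ℝ, Monotone T ∧ ρ.map T = μ := by
  have pos : ∀ z, 0 < cdf ρ z := fun z ↦
    (cdf_nonneg ρ (z - 1)).trans_lt (strictMono_cdf ρ (by linarith))
  have lt_one : ∀ z, cdf ρ z < 1 := fun z ↦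
    (strictMono_cdf ρ (show z < z + 1 by linarith)).trans_le (cdf_le_one ρ _)
  let A : ℝ → Set ℝ := fun z ↦ {x | cdf ρ z ≤ cdf μ x}
  have ne : ∀ z, (A z).Nonempty := fun z ↦
    ((tendsto_cdf_atTop μ).eventually (lt_mem_nhds (lt_one z))).exists.imp fun _ h ↦ h.le
  have bdd : ∀ z, BddBelow (A z) := fun z ↦ by
    obtain ⟨y, hy⟩ := ((tendsto_cdf_atBot μ).eventually (gt_mem_nhds (pos z))).exists
    refine ⟨y, fun x hx ↦ ?_⟩
    by_contra! h
    exact absurd (hx.trans (monotone_cdf μ h.le)) (not_le.2 hy)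
  -- Galois connection of the quantile function; right continuity of the cdf puts the infimum in `A
  -- z`.
  have gal : ∀ z x, sInf (A z) ≤ x ↔ cdf ρ z ≤ cdf μ x := fun z x ↦ by
    refine ⟨fun h ↦ ?_, fun h ↦ csInf_le (bdd z) h⟩
    have hr : Filter.Tendsto (cdf μ) (nhdsWithin x (Set.Ioi x)) (nhds (cdf μ x)) :=
      ((cdf μ).right_continuous x).mono_left (nhdsWithin_mono _ Set.Ioi_subset_Ici_self)
    refine ge_of_tendsto hr ?_
    filter_upwards [self_mem_nhdsWithin] with y hy
    obtain ⟨w, hw, hwy⟩ := exists_lt_of_csInf_lt (ne z) (h.trans_lt hy)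
    exact le_trans hw (monotone_cdf μ hwy.le)
  have mono : Monotone fun z ↦ sInf (A z) := fun z w hzw ↦
    csInf_le_csInf (bdd z) (ne w) fun x hx ↦ (monotone_cdf ρ hzw).trans hx
  refine ⟨fun z ↦ sInf (A z), mono, ?_⟩
  have := Measure.isProbabilityMeasure_map (μ := ρ) mono.measurable.aemeasurable
  refine Measure.ext_of_Iic _ _ fun x ↦ ?_
  rw [Measure.map_apply mono.measurable measurableSet_Iic]
  have e : (fun z ↦ sInf (A z)) ⁻¹' Set.Iic x = {z | cdf ρ z ≤ cdf μ x} := by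
    ext z; exact gal z x
  rw [e, ← ofReal_cdf μ]
  -- The values 0 and 1 are never attained by `cdf ρ`, hence separate cases.
  rcases (cdf_nonneg μ x).eq_or_lt with h0 | h0
  · rw [← h0]
    simp [not_le.2 (pos _)]
  rcases (cdf_le_one μ x).eq_or_lt with h1 | h1
  · simp [h1, cdf_le_one]
  obtain ⟨z, hz⟩ : ∃ z, cdf ρ z = cdf μ x := by
    obtain ⟨a, ha⟩ := ((tendsto_cdf_atBot ρ).eventually (gt_mem_nhds h0)).exists
    obtain ⟨b, hb⟩ := ((tendsto_cdf_atTop ρ).eventually (lt_mem_nhds h1)).exists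
    exact mem_range_of_exists_le_of_exists_ge (continuous_cdf ρ) ⟨a, ha.le⟩ ⟨b, hb.le⟩
  rw [← hz, ofReal_cdf]
  congr 1
  ext w
  exact (strictMono_cdf ρ).le_iff_le

end Rearrangement

/-! ### Segments and orthogonal projection in a Hilbert space -/

section Hilbert

variable {H : Type*} [NormedAddCommGroup H] [InnerProductSpace ℝ H]

/-- Strict convexity of the norm: equality in the triangle inequality holds only along the segment.
-/
lemma eq_lineMap_of_dist_eq_abs_mul {f : unitInterval → H}
    (hf : ∀ s t : unitInterval, dist (f s) (f t) = |(s : ℝ) - t| * dist (f 0) (f 1))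
    (t : unitInterval) : f t = AffineMap.lineMap (f 0) (f 1) (t : ℝ) := by
  apply eq_lineMap_of_dist_eq_mul_of_dist_eq_mul
  · rw [hf 0 t]
    simp [abs_of_nonneg t.2.1]
  · rw [hf t 1, abs_sub_comm]
    simp [abs_of_nonneg (sub_nonneg.2 t.2.2)]

lemma edist_lineMap_lineMap_eq (x y : H) (s t : ℝ) :
    edist (AffineMap.lineMap x y s : H) (AffineMap.lineMap x y t) =
      ENNReal.ofReal |s - t| * edist x y := by
  rw [edist_dist, dist_lineMap_lineMap, ENNReal.ofReal_mul dist_nonneg, edist_dist, Real.dist_eq]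

lemma edist_sq_eq_add_of_inner_eq_zero {x y z : H} (h : inner ℝ (x - y) (y - z) = 0) :
    edist x z ^ 2 = edist y z ^ 2 + edist x y ^ 2 := by
  have := norm_add_sq_eq_norm_sq_add_norm_sq_real h
  rw [sub_add_sub_cancel] at this
  simp_rw [edist_dist, dist_eq_norm, ← ENNReal.ofReal_pow (norm_nonneg _)]
  rw [← ENNReal.ofReal_add (by positivity) (by positivity)]
  congr 1
  nlinarith

/-- If orthogonal projection does not improve the sum of the squared distances from points fixed by
the projection to a segment, then the segment is fixed by the projection, or all the points have the
same nearest point on the segment, and that one is fixed. -/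
lemma fixed_of_sum_iInf_edist_sq_le {ι : Type*} [Fintype ι] [Nonempty ι] (p : H →ₗ[ℝ] H)
    (hp : ∀ x y, inner ℝ (x - p x) (p y) = 0) {g : ι → H} (hg : ∀ i, p (g i) = g i)
    {f : unitInterval → H} (hf : ∀ t, f t = AffineMap.lineMap (f 0) (f 1) (t : ℝ))
    (hle : ∑ i, ⨅ t, edist (f t) (g i) ^ 2 ≤ ∑ i, ⨅ t, edist (p (f t)) (g i) ^ 2) :
    (∀ t, p (f t) = f t) ∨
      ∃ t₀, p (f t₀) = f t₀ ∧ ∀ i, ⨅ t, edist (f t) (g i) ^ 2 = edist (f t₀) (g i) ^ 2 := by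
  have cont : Continuous f := by
    have h : f = fun t : unitInterval ↦ AffineMap.lineMap (f 0) (f 1) (t : ℝ) := funext hf
    rw [h]
    exact AffineMap.lineMap_continuous.comp continuous_subtype_val
  have hmin : ∀ i, ∃ t, ⨅ s, edist (f s) (g i) ^ 2 = edist (f t) (g i) ^ 2 := fun i ↦ by
    have hc : Continuous fun t ↦ edist (f t) (g i) ^ 2 :=
      (ENNReal.continuous_pow 2).comp (cont.edist continuous_const)
    obtain ⟨t, -, ht⟩ := isCompact_univ.exists_isMinOn Set.univ_nonempty hc.continuousOn
    exact ⟨t, le_antisymm (iInf_le _ _) (le_iInf fun s ↦ ht (Set.mem_univ s))⟩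
  choose τ hτ using hmin
  have pyth : ∀ i t, edist (f t) (g i) ^ 2 =
      edist (p (f t)) (g i) ^ 2 + edist (f t) (p (f t)) ^ 2 := fun i t ↦ by
    apply edist_sq_eq_add_of_inner_eq_zero
    rw [← hg i, ← map_sub]
    exact hp _ _
  have hfix : ∀ i, p (f (τ i)) = f (τ i) := by
    -- The projected curve, evaluated at the same parameters `τ i`, bounds the right side of `hle`;
    -- by Pythagoras the excess is the sum of squared distances to the projection.
    have h1 : ∑ i, edist (p (f (τ i))) (g i) ^ 2 + ∑ i, edist (f (τ i)) (p (f (τ i))) ^ 2 ≤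
        ∑ i, edist (p (f (τ i))) (g i) ^ 2 + 0 := by
      rw [← Finset.sum_add_distrib, add_zero]
      simp_rw [← pyth, ← hτ]
      exact hle.trans (Finset.sum_le_sum fun i _ ↦ iInf_le _ _)
    have h2 := ENNReal.le_of_add_le_add_left
      (ENNReal.sum_ne_top.2 fun i _ ↦ ENNReal.pow_ne_top (edist_ne_top _ _)) h1
    intro i
    have h3 := (Finset.sum_eq_zero_iff.1 (nonpos_iff_eq_zero.1 h2)) i (Finset.mem_univ i)
    exact (edist_eq_zero.1 (pow_eq_zero_iff two_ne_zero |>.1 h3)).symm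
  by_cases hall : ∀ i j, τ i = τ j
  · obtain ⟨i₀⟩ := ‹Nonempty ι›
    exact .inr ⟨τ i₀, hfix i₀, fun i ↦ by rw [hτ i, hall i i₀]⟩
  · push Not at hall
    obtain ⟨i, j, hij⟩ := hall
    refine .inl fun t ↦ ?_
    have hne : ((τ j : ℝ) - τ i) ≠ 0 := sub_ne_zero.2 fun h ↦ hij (Subtype.ext h.symm)
    -- Two fixed points at distinct parameters determine the whole segment affinely.
    have h : f t = AffineMap.lineMap (f (τ i)) (f (τ j)) (((t : ℝ) - τ i) / (τ j - τ i)) := by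
      rw [hf t, hf (τ i), hf (τ j)]
      simp only [AffineMap.lineMap_apply_module']
      match_scalars <;> field_simp <;> ring
    rw [h]
    simp only [AffineMap.lineMap_apply_module', map_add, map_smul, map_sub, hfix]

end Hilbert

/-! ### The isometric embedding into L² of the standard Gaussian -/

section Rearrangement

instance : NullSingletonClass (gaussianReal 0 1) := nullSingletonClass_gaussianReal one_ne_zero

instance : (gaussianReal 0 1).IsOpenPosMeasure :=
  (gaussianReal_absolutelyContinuous' 0 one_ne_zero).isOpenPosMeasure

/-- `T` is the monotone rearrangement of the standard Gaussian measure to `μ`. -/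
structure IsRearrangement (T : ℝ → ℝ) (μ : Measure ℝ) : Prop where
  monotone : Monotone T
  map_eq : (gaussianReal 0 1).map T = μ
  memLp : MemLp T 2 (gaussianReal 0 1)

lemma exists_isRearrangement {μ : Measure ℝ} (hμ : μ ∈ Prob₂) : ∃ T, IsRearrangement T μ := by
  obtain ⟨hμ, -, hL⟩ := hμ
  obtain ⟨T, hT, rfl⟩ := exists_monotone_map_eq (gaussianReal 0 1) μ
  refine ⟨T, hT, rfl, ?_⟩
  exact (memLp_map_measure_iff (by fun_prop) hT.measurable.aemeasurable).1 hL

lemma IsRearrangement.W₂_eq {T S : ℝ → ℝ} {μ ν : Measure ℝ} (hT : IsRearrangement T μ)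
    (hS : IsRearrangement S ν) : W₂ μ ν = edist (hT.memLp.toLp T) (hS.memLp.toLp S) := by
  rw [Lp.edist_toLp_toLp, ← W₂_map_map _ hT.monotone hS.monotone, hT.map_eq, hS.map_eq]

lemma IsRearrangement.eq_of_toLp_eq {T S : ℝ → ℝ} {μ ν : Measure ℝ} (hT : IsRearrangement T μ)
    (hS : IsRearrangement S ν) (h : hT.memLp.toLp T = hS.memLp.toLp S) : μ = ν := by
  rw [← hT.map_eq, ← hS.map_eq]
  exact Measure.map_congr ((MemLp.toLp_eq_toLp_iff _ _).1 h)

lemma cost_eq_sum_iInf_edist_sq {n : ℕ} {ν : Fin n → Measure ℝ} {μ : unitInterval → Measure ℝ}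
    {T : unitInterval → ℝ → ℝ} {S : Fin n → ℝ → ℝ} (hT : ∀ t, IsRearrangement (T t) (μ t))
    (hS : ∀ i, IsRearrangement (S i) (ν i)) :
    cost ν μ =
      ∑ i, ⨅ t, edist ((hT t).memLp.toLp (T t)) ((hS i).memLp.toLp (S i)) ^ 2 := by
  simp only [cost, (hT _).W₂_eq (hS _)]

/-- The integral is the slope of the affine projection of `T`. It could vanish only for `T` constant
almost everywhere, that is, for a Dirac mass, which absolute continuity excludes. -/
lemma IsRearrangement.integral_mul_pos {T : ℝ → ℝ} {μ : Measure ℝ} (hT : IsRearrangement T μ)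
    (hμ : μ ∈ Prob₂) : 0 < ∫ z, z * T z ∂gaussianReal 0 1 := by
  have hid : MemLp (fun z : ℝ ↦ z) 2 (gaussianReal 0 1) := memLp_id_gaussianReal' 2 (by simp)
  have i1 : Integrable (fun z ↦ z * T z) (gaussianReal 0 1) := hid.integrable_mul hT.memLp
  have i2 : Integrable (fun z : ℝ ↦ z) (gaussianReal 0 1) := hid.integrable (by simp)
  -- Subtracting `T 0` is free since the Gaussian is centred, and makes the integrand nonnegative.
  have e : ∫ z, z * T z ∂gaussianReal 0 1 = ∫ z, z * (T z - T 0) ∂gaussianReal 0 1 := by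
    simp_rw [mul_sub]
    rw [integral_sub i1 (i2.mul_const _), integral_mul_const, integral_id_gaussianReal]
    simp
  have nn : ∀ z, 0 ≤ z * (T z - T 0) := fun z ↦ by
    rcases le_total 0 z with h | h
    · exact mul_nonneg h (sub_nonneg.2 (hT.monotone h))
    · exact mul_nonneg_of_nonpos_of_nonpos h (sub_nonpos.2 (hT.monotone h))
  have i3 : Integrable (fun z ↦ z * (T z - T 0)) (gaussianReal 0 1) := by
    simp_rw [mul_sub]
    exact i1.sub (i2.mul_const _)
  rw [e]
  refine (integral_nonneg nn).lt_of_ne' fun h ↦ ?_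
  have h0 := (integral_eq_zero_iff_of_nonneg nn i3).1 h
  have hT0 : T =ᵐ[gaussianReal 0 1] fun _ ↦ T 0 := by
    have hz : ∀ᵐ z ∂gaussianReal 0 1, z ≠ 0 := by
      simp [ae_iff, measure_singleton]
    filter_upwards [h0, hz] with z h1 h2
    exact sub_eq_zero.1 ((mul_eq_zero.1 h1).resolve_left h2)
  have hdirac : μ = Measure.dirac (T 0) := by
    rw [← hT.map_eq, Measure.map_congr hT0, Measure.map_const, measure_univ, one_smul]
  have := hμ.2.1 (measure_singleton (μ := volume) (T 0))
  simp [hdirac] at this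

end Rearrangement

/-! ### Affine functions, their projection, and Gaussian geodesics -/

section Gaussian

lemma memLp_add_mul (a b : ℝ) : MemLp (fun z ↦ a + b * z) 2 (gaussianReal 0 1) :=
  (memLp_const a).add ((memLp_id_gaussianReal' 2 (by simp)).const_mul b)

/-- The class of the affine map `z ↦ a + b z` in `L²` of the standard Gaussian measure. -/
noncomputable def affineLp (a b : ℝ) : Lp ℝ 2 (gaussianReal 0 1) := (memLp_add_mul a b).toLp _

lemma isRearrangement_add_mul (a : ℝ) {b : ℝ} (hb : 0 ≤ b) :
    IsRearrangement (fun z ↦ a + b * z) (gaussianReal a (b.toNNReal ^ 2)) where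
  monotone := fun x y h ↦ by dsimp only; gcongr
  memLp := memLp_add_mul a b
  map_eq := by
    have : (fun z ↦ a + b * z) = (fun z ↦ a + z) ∘ fun z ↦ b * z := rfl
    rw [this, ← Measure.map_map (by fun_prop) (by fun_prop), gaussianReal_map_const_mul,
      gaussianReal_map_const_add]
    congr 1
    · simp
    · ext
      simp [hb]

lemma gaussianReal_mem_Prob₂ (a : ℝ) {v : ℝ≥0} (hv : v ≠ 0) : gaussianReal a v ∈ Prob₂ :=
  ⟨inferInstance, gaussianReal_absolutelyContinuous a hv, memLp_id_gaussianReal' 2 (by simp)⟩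

lemma affineLp_eq_add_smul (a b : ℝ) : affineLp a b = a • affineLp 1 0 + b • affineLp 0 1 := by
  simp only [affineLp, ← MemLp.toLp_const_smul, ← MemLp.toLp_add]
  congr 1
  ext z
  simp

lemma lineMap_affineLp (a₀ b₀ a₁ b₁ t : ℝ) :
    AffineMap.lineMap (affineLp a₀ b₀) (affineLp a₁ b₁) t =
      affineLp (AffineMap.lineMap a₀ a₁ t) (AffineMap.lineMap b₀ b₁ t) := by
  rw [affineLp_eq_add_smul a₀, affineLp_eq_add_smul a₁, affineLp_eq_add_smul (AffineMap.lineMap _ _ _)]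
  simp only [AffineMap.lineMap_apply_module', smul_eq_mul]
  module

lemma inner_affineLp_toLp (a b : ℝ) {T : ℝ → ℝ} (hT : MemLp T 2 (gaussianReal 0 1)) :
    inner ℝ (affineLp a b) (hT.toLp T) = ∫ z, (a + b * z) * T z ∂gaussianReal 0 1 := by
  rw [L2.inner_def]
  refine integral_congr_ae ?_
  filter_upwards [hT.coeFn_toLp, (memLp_add_mul a b).coeFn_toLp] with z h1 h2
  rw [affineLp, h1, h2]
  simp [mul_comm]

lemma integral_sq_gaussianReal : ∫ z, z * z ∂gaussianReal 0 1 = 1 := by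
  have h := variance_fun_id_gaussianReal (μ := 0) (v := 1)
  rw [variance_of_integral_eq_zero (by fun_prop) integral_id_gaussianReal] at h
  simpa [sq] using h

lemma inner_affineLp_affineLp (a b c d : ℝ) :
    inner ℝ (affineLp a b) (affineLp c d) = a * c + b * d := by
  have hid : MemLp (fun z : ℝ ↦ z) 2 (gaussianReal 0 1) := memLp_id_gaussianReal' 2 (by simp)
  have i1 : Integrable (fun z : ℝ ↦ z * z) (gaussianReal 0 1) := hid.integrable_mul hid
  have i2 : Integrable (fun z : ℝ ↦ z) (gaussianReal 0 1) := hid.integrable (by simp)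
  rw [affineLp.eq_def c d, inner_affineLp_toLp]
  have e : ∀ z, (a + b * z) * (c + d * z) = a * c + (a * d + b * c) * z + b * d * (z * z) :=
    fun z ↦ by ring
  simp_rw [e]
  have i3 : Integrable (fun z : ℝ ↦ a * c + (a * d + b * c) * z) (gaussianReal 0 1) :=
    (integrable_const _).add (i2.const_mul _)
  rw [integral_add i3 (i1.const_mul _),
    integral_add (integrable_const _) (i2.const_mul _), integral_const_mul _ (fun z ↦ z),
    integral_const_mul _ (fun z ↦ z * z), integral_sq_gaussianReal, integral_id_gaussianReal]
  simp

/-- The orthogonal projection of `L²` of the standard Gaussian measure onto the affine functions. -/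
noncomputable def affineProj : Lp ℝ 2 (gaussianReal 0 1) →ₗ[ℝ] Lp ℝ 2 (gaussianReal 0 1) :=
  (innerₗ _ (affineLp 1 0)).smulRight (affineLp 1 0) +
    (innerₗ _ (affineLp 0 1)).smulRight (affineLp 0 1)

lemma affineProj_apply (x : Lp ℝ 2 (gaussianReal 0 1)) :
    affineProj x = affineLp (inner ℝ (affineLp 1 0) x) (inner ℝ (affineLp 0 1) x) := by
  rw [affineLp_eq_add_smul (inner ℝ _ _)]
  rfl

lemma affineProj_affineLp (a b : ℝ) : affineProj (affineLp a b) = affineLp a b := by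
  simp [affineProj_apply, inner_affineLp_affineLp]

lemma inner_sub_affineProj (x y : Lp ℝ 2 (gaussianReal 0 1)) :
    inner ℝ (x - affineProj x) (affineProj y) = 0 := by
  rw [inner_sub_left, affineProj_apply x, affineProj_apply y, inner_affineLp_affineLp,
    affineLp_eq_add_smul (inner ℝ _ y), inner_add_right, inner_smul_right, inner_smul_right,
    real_inner_comm x (affineLp 1 0), real_inner_comm x (affineLp 0 1)]
  ring

/-- The displacement interpolation between two Gaussian measures. -/
noncomputable def gaussianSegment (a₀ b₀ a₁ b₁ : ℝ) (t : unitInterval) : Measure ℝ :=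
  gaussianReal (AffineMap.lineMap a₀ a₁ (t : ℝ))
    ((AffineMap.lineMap b₀ b₁ (t : ℝ) : ℝ).toNNReal ^ 2)

lemma lineMap_pos {b₀ b₁ : ℝ} (h₀ : 0 < b₀) (h₁ : 0 < b₁) (t : unitInterval) :
    0 < (AffineMap.lineMap b₀ b₁ (t : ℝ) : ℝ) :=
  (convex_Ioi (0 : ℝ)).lineMap_mem h₀ h₁ t.2

lemma isRearrangement_gaussianSegment (a₀ a₁ : ℝ) {b₀ b₁ : ℝ} (h₀ : 0 < b₀) (h₁ : 0 < b₁)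
    (t : unitInterval) :
    IsRearrangement (fun z ↦ AffineMap.lineMap a₀ a₁ (t : ℝ) + AffineMap.lineMap b₀ b₁ (t : ℝ) * z)
      (gaussianSegment a₀ b₀ a₁ b₁ t) :=
  isRearrangement_add_mul _ (lineMap_pos h₀ h₁ t).le

lemma isGeodesic_gaussianSegment (a₀ a₁ : ℝ) {b₀ b₁ : ℝ} (h₀ : 0 < b₀) (h₁ : 0 < b₁) :
    IsGeodesic (gaussianSegment a₀ b₀ a₁ b₁) := by
  refine ⟨fun t ↦ gaussianReal_mem_Prob₂ _ ?_, fun s t ↦ ?_⟩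
  · exact pow_ne_zero 2 (Real.toNNReal_pos.2 (lineMap_pos h₀ h₁ t)).ne'
  · have key : ∀ s t, W₂ (gaussianSegment a₀ b₀ a₁ b₁ s) (gaussianSegment a₀ b₀ a₁ b₁ t) =
        ENNReal.ofReal |(s : ℝ) - t| * edist (affineLp a₀ b₀) (affineLp a₁ b₁) := fun s t ↦ by
      rw [← edist_lineMap_lineMap_eq, lineMap_affineLp, lineMap_affineLp]
      exact (isRearrangement_gaussianSegment a₀ a₁ h₀ h₁ s).W₂_eq
        (isRearrangement_gaussianSegment a₀ a₁ h₀ h₁ t)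
    rw [key s t, key 0 1]
    simp

lemma cost_gaussianSegment {n : ℕ} {ν : Fin n → Measure ℝ} {S : Fin n → ℝ → ℝ}
    (hS : ∀ i, IsRearrangement (S i) (ν i)) (a₀ a₁ : ℝ) {b₀ b₁ : ℝ} (h₀ : 0 < b₀) (h₁ : 0 < b₁) :
    cost ν (gaussianSegment a₀ b₀ a₁ b₁) = ∑ i, ⨅ t : unitInterval,
      edist (AffineMap.lineMap (affineLp a₀ b₀) (affineLp a₁ b₁) (t : ℝ))
        ((hS i).memLp.toLp (S i)) ^ 2 := by
  rw [cost_eq_sum_iInf_edist_sq (isRearrangement_gaussianSegment a₀ a₁ h₀ h₁) hS]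
  simp_rw [lineMap_affineLp]
  rfl

end Gaussian

/-- If all the projections of the data on a geodesic are the same Gaussian measure, then the
geodesic is not a first component. -/
lemma exists_isGeodesic_cost_lt {n : ℕ} {ν : Fin n → Measure ℝ} (m : Fin n → ℝ) {σ : Fin n → ℝ}
    (hσ : ∀ i, 0 < σ i) (hν : ∀ i, IsRearrangement (fun z ↦ m i + σ i * z) (ν i))
    (hne : ∃ i j, ν i ≠ ν j) (a : ℝ) {b : ℝ} (hb : 0 < b) :
    ∃ η, IsGeodesic η ∧ cost ν η < ∑ i, edist (affineLp a b) (affineLp (m i) (σ i)) ^ 2 := by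
  obtain ⟨j, hj⟩ : ∃ j, affineLp a b ≠ affineLp (m j) (σ j) := by
    by_contra! h
    obtain ⟨i, j, hij⟩ := hne
    exact hij ((hν i).eq_of_toLp_eq (hν j) ((h i).symm.trans (h j)))
  refine ⟨gaussianSegment a b (m j) (σ j), isGeodesic_gaussianSegment a (m j) hb (hσ j), ?_⟩
  rw [cost_gaussianSegment hν a (m j) hb (hσ j)]
  have le : ∀ i ∈ Finset.univ, ⨅ t : unitInterval,
      edist (AffineMap.lineMap (affineLp a b) (affineLp (m j) (σ j)) (t : ℝ))
        (affineLp (m i) (σ i)) ^ 2 ≤ edist (affineLp a b) (affineLp (m i) (σ i)) ^ 2 :=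
    fun i _ ↦ (iInf_le _ 0).trans_eq (by simp)
  rw [← Finset.add_sum_erase _ _ (Finset.mem_univ j), ← Finset.add_sum_erase _ _ (Finset.mem_univ j)]
  refine ENNReal.add_lt_add_of_lt_of_le ?_ ?_ ?_
  · refine ENNReal.sum_ne_top.2 fun i _ ↦ ne_top_of_le_ne_top ?_ (le i (Finset.mem_univ i))
    exact ENNReal.pow_ne_top (edist_ne_top _ _)
  -- At `t = 1` the segment reaches the `j`-th datum, whose residual drops to 0.
  · refine (iInf_le _ 1).trans_lt ?_
    have : 0 < edist (affineLp a b) (affineLp (m j) (σ j)) := edist_pos.2 hj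
    simpa [affineLp] using ENNReal.pow_pos this 2
  · exact Finset.sum_le_sum fun i _ ↦ le i (Finset.mem_univ i)

/-- A first principal geodesic component of Gaussian measures consists of Gaussian measures. -/
theorem IsFirstComponent.exists_eq_gaussianReal {n : ℕ} (m : Fin n → ℝ) (σ : Fin n → ℝ≥0)
    (hσ : ∀ i, 0 < σ i)
    (ν : Fin n → Measure ℝ) (hν : ∀ i, ν i = gaussianReal (m i) (σ i ^ 2))
    (hne : ∃ i j, ν i ≠ ν j)
    (μ : unitInterval → Measure ℝ) (hμ : IsFirstComponent ν μ) :
    ∀ t : unitInterval, ∃ (a : ℝ) (s : ℝ≥0), 0 < s ∧ μ t = gaussianReal a (s ^ 2) := by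
  obtain ⟨⟨hP, hgeo⟩, hmin⟩ := hμ
  have : Nonempty (Fin n) := ⟨hne.choose⟩
  have hσ' : ∀ i, 0 < (σ i : ℝ) := fun i ↦ hσ i
  have hS : ∀ i, IsRearrangement (fun z ↦ m i + σ i * z) (ν i) := fun i ↦ by
    simpa [hν i] using isRearrangement_add_mul (m i) (hσ' i).le
  choose T hT using fun t ↦ exists_isRearrangement (hP t)
  let f : unitInterval → Lp ℝ 2 (gaussianReal 0 1) := fun t ↦ (hT t).memLp.toLp (T t)
  have hf : ∀ t, f t = AffineMap.lineMap (f 0) (f 1) (t : ℝ) :=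
    eq_lineMap_of_dist_eq_abs_mul fun s t ↦ by
      have h := hgeo s t
      rw [(hT s).W₂_eq (hT t), (hT 0).W₂_eq (hT 1)] at h
      have h' := congrArg ENNReal.toReal h
      rwa [ENNReal.toReal_mul, ENNReal.toReal_ofReal (abs_nonneg _), ← dist_edist, ← dist_edist]
        at h'
  have hpos : ∀ t, 0 < inner ℝ (affineLp 0 1) (f t) := fun t ↦ by
    simpa [f, inner_affineLp_toLp] using (hT t).integral_mul_pos (hP t)
  have hcost : cost ν μ = ∑ i, ⨅ t, edist (f t) (affineLp (m i) (σ i)) ^ 2 :=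
    cost_eq_sum_iInf_edist_sq hT hS
  -- The projected curve is a Gaussian segment with endpoint slopes positive by `hpos`, hence an
  -- admissible competitor.
  have hle : ∑ i, ⨅ t, edist (f t) (affineLp (m i) (σ i)) ^ 2 ≤
      ∑ i, ⨅ t, edist (affineProj (f t)) (affineLp (m i) (σ i)) ^ 2 := by
    rw [← hcost]
    refine (hmin _ (isGeodesic_gaussianSegment (inner ℝ (affineLp 1 0) (f 0))
      (inner ℝ (affineLp 1 0) (f 1)) (hpos 0) (hpos 1))).trans_eq ?_
    rw [cost_gaussianSegment hS _ _ (hpos 0) (hpos 1), ← affineProj_apply, ← affineProj_apply]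
    refine Finset.sum_congr rfl fun i _ ↦ iInf_congr fun t ↦ ?_
    rw [hf t]
    simp only [AffineMap.lineMap_apply_module', map_add, map_smul, map_sub]
    rfl
  rcases fixed_of_sum_iInf_edist_sq_le affineProj inner_sub_affineProj
    (fun i ↦ affineProj_affineLp (m i) (σ i)) hf hle with h | ⟨t₀, ht₀, hinf⟩
  · intro t
    refine ⟨inner ℝ (affineLp 1 0) (f t), (inner ℝ (affineLp 0 1) (f t) : ℝ).toNNReal,
      Real.toNNReal_pos.2 (hpos t), ?_⟩
    refine (hT t).eq_of_toLp_eq (isRearrangement_add_mul _ (hpos t).le) ?_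
    exact (h t).symm.trans (affineProj_apply _)
  · obtain ⟨η, hη, hlt⟩ := exists_isGeodesic_cost_lt m hσ' hS hne (inner ℝ (affineLp 1 0) (f t₀))
      (hpos t₀)
    rw [← affineProj_apply, ht₀] at hlt
    simp_rw [← hinf] at hlt
    rw [← hcost] at hlt
    exact absurd (hmin η hη) (not_le.2 hlt)

end GeodesicPCA

theorem proposition4 (n : ℕ) (m : Fin n → ℝ) (σ : Fin n → ℝ≥0) (hσ : ∀ i, 0 < σ i)
    (ν : Fin n → Measure ℝ) (hν : ∀ i, ν i = gaussianReal (m i) (σ i ^ 2))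
    (hne : ∃ i j, ν i ≠ ν j)
    (μ : unitInterval → Measure ℝ) (hμ : GeodesicPCA.IsFirstComponent ν μ) :
    ∀ t : unitInterval, ∃ (a : ℝ) (s : ℝ≥0), 0 < s ∧ μ t = gaussianReal a (s ^ 2) := by
  exact hμ.exists_eq_gaussianReal m σ hσ ν hν hne μ
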